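/- Consider the $K$-armed bandit problem over $T$ rounds, $1\le K\le T$, against an adaptive, possibly randomized, adversary: in round $t$ the adversary chooses a loss vector $\ell_t\in[0,1]^K$, which may depend on its own randomness and on the arms $i_1,\dots,i_{t-1}$ pulled before; the learner pulls an arm $i_t\in[K]$ and observes only $c_t=\ell_{t,i_t}$. Put $\ell_0=\mathbf 0$, $c_0=0$ and $$\mathrm{Reg}=\max_{i\in[K]}\mathbb E\Big[\sum_{t=1}^T\ell_{t,i_t}-\sum_{t=1}^T\ell_{t,i}\Big],\qquad V_\infty=\mathbb E\Big[\sum_{t=1}^T\|\ell_t-\ell_{t-1}\|_\infty\Big],$$ the expectations being over the randomness of both players. For parameters $\eta>0$ and $\alpha\in(0,1)$ the learner runs the following algorithm. Let $\psi(x)=\frac1\eta\sum_{i=1}^K\ln\frac1{x_i}$, with Bregman divergence $D_\psi(x,y)=\psi(x)-\psi(y)-\langle\nabla\psi(y),x-y\rangle$, let $\Delta_K$ be the probability simplex, and let $x_1=w_1$ be the uniform distribution on $[K]$. In each round $t=1,\dots,T$: (1) draw $i_t\sim w_t$ and observe $c_t=\ell_{t,i_t}$; (2) set $\hat\ell_{t,i}=\frac{\ell_{t,i}-c_{t-1}}{w_{t,i}}\mathbf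 1\{i_t=i\}+c_{t-1}$ for all $i\in[K]$; (3) set $x_{t+1}=\arg\min_{x\in\Delta_K}\langle x,\hat\ell_t\rangle+D_\psi(x,x_t)$; (4) set $w_{t+1}=(1-\alpha_{t+1})x_{t+1}+\alpha_{t+1}\mathbf e_{i_t}$, where $\alpha_{t+1}=\frac{\alpha(1-c_t)}{1+\alpha(1-c_t)}$ and $\mathbf e_{i}$ is the $i$-th standard basis vector. Theorem. There is a universal constant $C>0$ such that the following holds for all $1\le K\le T$. (a) For every $0<\eta\le\frac1{162}$, the algorithm with $\alpha=8\eta$ satisfies, against every adaptive adversary, $$\mathrm{Reg}\le C\Big(\frac{K\ln T}{\eta}+\eta\,\mathbb E\Big[\sum_{t=1}^{T-1}|\ell_{t+1,i_t}-\ell_{t,i_t}|\Big]\Big)\quad\text{and}\quad \mathrm{Reg}\le C\Big(\frac{K\ln T}{\eta}+\eta V_\infty\Big).$$ (b) With a tuned learning rate the regret is $O(\sqrt{KV_\infty\ln T}+K\ln T)$. Precisely: for every $V\ge0$ there is $\eta\in(0,\frac1{162}]$, depending only on $K,T,V$, such that the algorithm with this $\eta$ and $\alpha=8\eta$ satisfies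 $\mathrm{Reg}\le C\big(\sqrt{KV\ln T}+K\ln T\big)$ against every adaptive adversary for which $V_\infty\le V$ when it plays against this algorithm; and for every adaptive adversary there is $\eta\in(0,\frac1{162}]$ such that the algorithm with this $\eta$ and $\alpha=8\eta$ satisfies $\mathrm{Reg}\le C\big(\sqrt{KV_\infty\ln T}+K\ln T\big)$, where $V_\infty$ is the path-length of the same run. -/

import Mathlib

open MeasureTheory

universe u

noncomputable section

namespace Bandit

variable {K T : ℕ} {Ξ : Type*} [MeasurableSpace Ξ]

/-! ### The mirror descent update -/

/-- The log-barrier `ψ(x) = (1/η) ∑ᵢ ln (1 / xᵢ)`. -/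
def logBarrier (η : ℝ) (x : Fin K → ℝ) : ℝ :=
  (1 / η) * ∑ i, Real.log (1 / x i)

/-- The Bregman divergence `D_ψ(x, y) = ψ(x) - ψ(y) - ⟨∇ψ(y), x - y⟩`. -/
def bregman (ψ : (Fin K → ℝ) → ℝ) (x y : Fin K → ℝ) : ℝ :=
  ψ x - ψ y - fderiv ℝ ψ y (x - y)

/-- The points of the probability simplex at which the log-barrier is finite. As the log-barrier is
`+∞` at every other point of the simplex, minimizing over the simplex is minimizing over this set
(`Real.log 0 = 0` would give a wrong value on the boundary). -/
def posSimplex (K : ℕ) : Set (Fin K → ℝ) :=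
  {x | x ∈ stdSimplex ℝ (Fin K) ∧ ∀ i, 0 < x i}

/-- The (unique) minimizer of `z ↦ ⟨z, g⟩ + D_ψ(z, x)` over the simplex, `ψ` the log-barrier. -/
def mirrorStep (η : ℝ) (x g : Fin K → ℝ) : Fin K → ℝ :=
  Classical.epsilon fun z => z ∈ posSimplex K ∧
    IsMinOn (fun y => ∑ i, y i * g i + bregman (logBarrier η) y x) (posSimplex K) z

/-! ### The algorithm -/

/-- What the learner keeps between rounds: the mirror descent iterate `x`, the sampling
distribution `w` for the coming round, and the last observed loss `c`. -/
structure State (K : ℕ) where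
  x : Fin K → ℝ
  w : Fin K → ℝ
  c : ℝ

/-- The state before the first round. -/
def State.init (K : ℕ) : State K where
  x := fun _ => 1 / (K : ℝ)
  w := fun _ => 1 / (K : ℝ)
  c := 0

/-- The loss estimator built from the pulled arm `i` and the loss `y` observed on it. -/
def State.estimator (s : State K) (i : Fin K) (y : ℝ) : Fin K → ℝ :=
  fun j => (if j = i then (y - s.c) / s.w j else 0) + s.c

/-- The fraction of the weight that is moved to the last pulled arm, after observing loss `y`. -/
def biasFraction (α y : ℝ) : ℝ :=
  α * (1 - y) / (1 + α * (1 - y))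

/-- The update at the end of a round in which arm `i` was pulled and loss `y` was observed. -/
def State.step (η α : ℝ) (s : State K) (i : Fin K) (y : ℝ) : State K where
  x := mirrorStep η s.x (s.estimator i y)
  w := fun j => (1 - biasFraction α y) * mirrorStep η s.x (s.estimator i y) j
    + biasFraction α y * (Pi.single i 1 : Fin K → ℝ) j
  c := y

/-- The learner's state after `t` rounds in which it pulled the arms `h` and observed the
losses `y`. -/
def run (η α : ℝ) : (t : ℕ) → (h : Fin t → Fin K) → (y : Fin t → ℝ) → State K
  | 0, _, _ => State.init K
  | t + 1, h, y =>
      (run η α t (Fin.init h) (Fin.init y)).step η α (h (Fin.last t)) (y (Fin.last t))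

/-! ### The game against an adaptive adversary -/

/-- The first `t` entries of a sequence of arms. -/
def pre (a : Fin T → Fin K) (t : ℕ) (ht : t ≤ T) : Fin t → Fin K :=
  fun s => a (Fin.castLE ht s)

/-- An adaptive, possibly randomized, adversary for `K` arms; `Ξ` carries its randomness.
`loss t h ξ` is the loss vector of round `t + 1` when the learner pulled the arms `h` in
the `t` rounds before. -/
structure Adversary (K : ℕ) (Ξ : Type*) [MeasurableSpace Ξ] where
  loss : (t : ℕ) → (Fin t → Fin K) → Ξ → Fin K → ℝ
  measurable_loss : ∀ t h, Measurable (loss t h)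
  loss_mem : ∀ t h ξ i, loss t h ξ i ∈ Set.Icc (0 : ℝ) 1

namespace Adversary

/-- The losses that the learner observes when it pulls the arms `h`. -/
def observed (A : Adversary K Ξ) (ξ : Ξ) {t : ℕ} (h : Fin t → Fin K) : Fin t → ℝ :=
  fun s => A.loss s (pre h s s.isLt.le) ξ (h s)

/-- The loss vector `ℓ_t`, for `t = 0, 1, …, T`, when the learner pulls the arms
`a = (i_1, …, i_T)`; by convention `ℓ_0 = 0`. -/
def lossVec (A : Adversary K Ξ) (ξ : Ξ) (a : Fin T → Fin K) : (t : ℕ) → t ≤ T → Fin K → ℝ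
  | 0, _ => 0
  | s + 1, h => A.loss s (pre a s (Nat.le_of_succ_le h)) ξ

/-- The distribution from which the learner draws its next arm after having pulled the arms `h`. -/
def playDist (A : Adversary K Ξ) (η α : ℝ) (ξ : Ξ) {t : ℕ} (h : Fin t → Fin K) : Fin K → ℝ :=
  (run η α t h (A.observed ξ h)).w

/-- The probability that the learner pulls the arms `a` in the `T` rounds, given `ξ`. -/
def pathProb (A : Adversary K Ξ) (η α : ℝ) (ξ : Ξ) (a : Fin T → Fin K) : ℝ :=
  ∏ t : Fin T, A.playDist η α ξ (pre a t t.isLt.le) (a t)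

/-- Expectation over the randomness of the adversary and of the learner. -/
def expect (A : Adversary K Ξ) (P : Measure Ξ) (η α : ℝ) (f : Ξ → (Fin T → Fin K) → ℝ) : ℝ :=
  ∫ ξ, ∑ a : Fin T → Fin K, A.pathProb η α ξ a * f ξ a ∂P

/-- The pseudo-regret after `T` rounds. -/
def regret (A : Adversary K Ξ) (P : Measure Ξ) (T : ℕ) (η α : ℝ) : ℝ :=
  ⨆ i : Fin K, A.expect P η α fun ξ (a : Fin T → Fin K) =>
    ∑ t : Fin T, A.lossVec ξ a (t + 1) t.isLt (a t) - ∑ t : Fin T, A.lossVec ξ a (t + 1) t.isLt i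

/-- `E [∑_{t=1}^{T-1} |ℓ_{t+1, i_t} - ℓ_{t, i_t}|]` -/
def pulledVariation (A : Adversary K Ξ) (P : Measure Ξ) (T : ℕ) (η α : ℝ) : ℝ :=
  A.expect P η α fun ξ (a : Fin T → Fin K) => ∑ t : Fin (T - 1),
    |A.lossVec ξ a (t + 2) (by omega) (a ⟨t, by omega⟩)
      - A.lossVec ξ a (t + 1) (by omega) (a ⟨t, by omega⟩)|

/-- The max-norm path-length `V_∞ = E [∑_{t=1}^T ‖ℓ_t - ℓ_{t-1}‖_∞]`
(the norm of `Fin K → ℝ` is the max-norm). -/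
def maxPathLength (A : Adversary K Ξ) (P : Measure Ξ) (T : ℕ) (η α : ℝ) : ℝ :=
  A.expect P η α fun ξ (a : Fin T → Fin K) => ∑ t : Fin T,
    ‖A.lossVec ξ a (t + 1) t.isLt - A.lossVec ξ a t t.isLt.le‖

end Adversary

end Bandit

end

/-!
The log-barrier makes every mirror descent step explicit: the minimizer is `xᵢ = 1 / (vᵢ + λ)` with
`vᵢ = 1 / x_{t,i} + η ℓ̂_{t,i}` and `λ` the multiplier of the constraint `∑ᵢ xᵢ = 1`
(`mirrorStep_eq_barrierArgmin`), and this map is nonexpansive in `v`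
(`sum_sq_barrierArgmin_sub_le`). Hence the arm probabilities are measurable in the randomness of the
adversary and continuous in `η`.

For the regret, one round of mirror descent against the unbiased estimator costs at most the drop of
the divergence to the comparator plus `4 η (c_t - c_{t-1})²` (`estimator_regret_le`): the estimator
is a single coordinate up to a multiple of the all-ones vector, and the weight `x_{t,i}` of the
pulled arm is at most `(1 + α) w_{t,i}`. Sampling from `w_t` instead of `x_t` costs
`α (1 - c_{t-1}) (ℓ_{t,i_{t-1}} - ⟨w_t, ℓ_t⟩)` (`sum_w_sub_sum_x_step`), and `⟨w_t, ℓ_t⟩` is the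
conditional expectation of `c_t`. Replacing `ℓ_{t,i_{t-1}}` by `c_{t-1}` costs
`α |ℓ_{t,i_{t-1}} - ℓ_{t-1,i_{t-1}}|`, and with `d_t = 1 - c_t`, `α = 8 η` the rest is
`8 η d_{t-1} (d_t - d_{t-1}) = 4 η (d_t² - d_{t-1}²) - 4 η (c_t - c_{t-1})²`.
The first part telescopes and the second cancels the stability term. So `lyapunov`, the divergence
minus `4 η d_t²`, decreases in expectation up to the regret and the variation of the pulled arm
(`sum_playDist_mul_lyapunov_le`); summing over the rounds gives `regret_le`, the first bound of the
theorem, and the second follows as the variation of a pulled arm is at most the path-length.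

The tuned bounds balance `K ln T / η` against `η V`. When `V` is the path-length of the run itself,
it depends on `η`; as it is continuous in `η` and at most `T`, the intermediate value theorem gives
the balancing `η` (`exists_rate_of_continuousOn`).
-/

namespace Bandit

/-! ### The mirror descent update in closed form -/

theorem fderiv_logBarrier {K : ℕ} (η : ℝ) {x : Fin K → ℝ} (hx : ∀ i, 0 < x i) (v : Fin K → ℝ) :
    fderiv ℝ (logBarrier η) x v = -(1 / η) * ∑ i, v i / x i := by
  have h : HasFDerivAt (logBarrier η)
      ((1 / η) • ∑ i, -((x i)⁻¹ • (ContinuousLinearMap.proj i : (Fin K → ℝ) →L[ℝ] ℝ))) x := by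
    have h1 : ∀ i ∈ Finset.univ, HasFDerivAt (fun y : Fin K → ℝ => Real.log (1 / y i))
        (-((x i)⁻¹ • (ContinuousLinearMap.proj i : (Fin K → ℝ) →L[ℝ] ℝ))) x := by
      intro i _
      have := ((hasFDerivAt_apply (𝕜 := ℝ) i x).log (hx i).ne').neg
      simp only [one_div, Real.log_inv]
      exact this
    exact (HasFDerivAt.fun_sum h1).const_mul (1 / η)
  rw [h.fderiv]
  simp [Finset.sum_neg_distrib, div_eq_inv_mul]

theorem bregman_logBarrier {K : ℕ} (η : ℝ) {x : Fin K → ℝ} (hx : ∀ i, 0 < x i)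
    (y : Fin K → ℝ) :
    bregman (logBarrier η) y x
      = (1 / η) * ∑ i, (y i / x i - 1 - (Real.log (y i) - Real.log (x i))) := by
  rw [bregman, fderiv_logBarrier η hx, logBarrier, logBarrier, ← mul_sub, ← Finset.sum_sub_distrib,
    neg_mul, sub_neg_eq_add, ← mul_add, ← Finset.sum_add_distrib]
  congr 1
  refine Finset.sum_congr rfl fun i _ => ?_
  have := (hx i).ne'
  simp only [one_div, Real.log_inv, Pi.sub_apply]
  field_simp
  ring

theorem exists_normalizer {K : ℕ} (hK : 0 < K) (v : Fin K → ℝ) :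
    ∃ l : ℝ, (∀ i, 0 < v i + l) ∧ ∑ i, (v i + l)⁻¹ = 1 := by
  have : Nonempty (Fin K) := ⟨⟨0, hK⟩⟩
  obtain ⟨i₀, hi₀⟩ := Finite.exists_min v
  have hK1 : (1 : ℝ) ≤ K := by exact_mod_cast hK
  have hpos : ∀ l, 1 - v i₀ ≤ l → ∀ i, 0 < v i + l := fun l hl i => by linarith [hi₀ i]
  have hcont : ContinuousOn (fun l => ∑ i, (v i + l)⁻¹) (Set.Icc (1 - v i₀) (K - v i₀)) :=
    continuousOn_finsetSum _ fun i _ =>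
      (continuousOn_const.add continuousOn_id).inv₀ fun l hl => (hpos l hl.1 i).ne'
  have hmem : (1 : ℝ) ∈ Set.Icc (∑ i, (v i + (K - v i₀))⁻¹) (∑ i, (v i + (1 - v i₀))⁻¹) := by
    constructor
    · calc ∑ i, (v i + (K - v i₀))⁻¹ ≤ ∑ _i : Fin K, (K : ℝ)⁻¹ := by
            refine Finset.sum_le_sum fun i _ => inv_anti₀ (by linarith) (by linarith [hi₀ i])
        _ = 1 := by simp [show (K : ℝ) ≠ 0 by positivity]
    · calc (1 : ℝ) = (v i₀ + (1 - v i₀))⁻¹ := by simp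
        _ ≤ _ := Finset.single_le_sum (f := fun i => (v i + (1 - v i₀))⁻¹)
            (fun i _ => (inv_pos.2 (hpos _ le_rfl i)).le) (Finset.mem_univ i₀)
  obtain ⟨l, hl, h1⟩ := intermediate_value_Icc' (by linarith) hcont hmem
  exact ⟨l, hpos l hl.1, h1⟩

/-- The shift `l` that turns `i ↦ 1 / (v i + l)` into a positive point of the simplex; it is the
Lagrange multiplier of the constraint `∑ᵢ xᵢ = 1` in a mirror descent step. -/
noncomputable def normalizer {K : ℕ} (v : Fin K → ℝ) : ℝ :=
  Classical.epsilon fun l => (∀ i, 0 < v i + l) ∧ ∑ i, (v i + l)⁻¹ = 1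

/-- The minimizer of `x ↦ ⟨x, v⟩ + ∑ᵢ ln (1 / xᵢ)` over the simplex, in closed form. -/
noncomputable def barrierArgmin {K : ℕ} (v : Fin K → ℝ) : Fin K → ℝ :=
  fun i => (v i + normalizer v)⁻¹

theorem barrierArgmin_mem {K : ℕ} (hK : 0 < K) (v : Fin K → ℝ) :
    barrierArgmin v ∈ posSimplex K := by
  obtain ⟨hp, h1⟩ := Classical.epsilon_spec (exists_normalizer hK v)
  exact ⟨⟨fun i => (inv_pos.2 (hp i)).le, h1⟩, fun i => inv_pos.2 (hp i)⟩

theorem inv_barrierArgmin {K : ℕ} (v : Fin K → ℝ) (i : Fin K) :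
    (barrierArgmin v i)⁻¹ = v i + normalizer v := inv_inv _

theorem sum_eq_one_of_mem_posSimplex {K : ℕ} {x : Fin K → ℝ} (hx : x ∈ posSimplex K) :
    ∑ i, x i = 1 := hx.1.2

theorem le_one_of_mem_posSimplex {K : ℕ} {x : Fin K → ℝ} (hx : x ∈ posSimplex K) (i : Fin K) :
    x i ≤ 1 := by
  rw [← hx.1.2]
  exact Finset.single_le_sum (fun j _ => hx.1.1 j) (Finset.mem_univ i)

/-- The first-order condition, in the form of an exact identity for the excess of the objective. -/
theorem objective_sub_objective_argmin {K : ℕ} (hK : 0 < K) {η : ℝ} (hη : 0 < η)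
    {x y : Fin K → ℝ} (g : Fin K → ℝ) (hx : ∀ i, 0 < x i) (hy : y ∈ posSimplex K) :
    let z := barrierArgmin fun i => (x i)⁻¹ + η * g i
    (∑ i, y i * g i + bregman (logBarrier η) y x) - (∑ i, z i * g i + bregman (logBarrier η) z x)
      = (1 / η) * ∑ i, (y i / z i - 1 - Real.log (y i / z i)) := by
  intro z
  have hz : z ∈ posSimplex K := barrierArgmin_mem hK _
  have hg : ∀ i, g i = (1 / η) * ((z i)⁻¹ - (x i)⁻¹ - normalizer fun i => (x i)⁻¹ + η * g i) := by
    intro i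
    rw [show (z i)⁻¹ = _ from inv_barrierArgmin _ i]
    field_simp
    ring
  set l := normalizer fun i => (x i)⁻¹ + η * g i
  have hsum : ∑ i, (y i - z i) * l = 0 := by
    rw [← Finset.sum_mul, Finset.sum_sub_distrib, sum_eq_one_of_mem_posSimplex hy,
      sum_eq_one_of_mem_posSimplex hz]
    ring
  rw [bregman_logBarrier η hx, bregman_logBarrier η hx, ← sub_eq_zero]
  rw [show (0 : ℝ) = -(1 / η) * ∑ i, (y i - z i) * l by rw [hsum, mul_zero]]
  simp only [Finset.mul_sum]
  rw [← Finset.sum_add_distrib, ← Finset.sum_add_distrib, ← Finset.sum_sub_distrib,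
    ← Finset.sum_sub_distrib]
  refine Finset.sum_congr rfl fun i _ => ?_
  have h1 := (hx i).ne'
  have h2 := (hz.2 i).ne'
  have h3 := (hy.2 i).ne'
  rw [Real.log_div h3 h2, hg i]
  field_simp
  ring

theorem mirrorStep_eq_barrierArgmin {K : ℕ} (hK : 0 < K) {η : ℝ} (hη : 0 < η) {x : Fin K → ℝ}
    (g : Fin K → ℝ) (hx : ∀ i, 0 < x i) :
    mirrorStep η x g = barrierArgmin fun i => (x i)⁻¹ + η * g i := by
  set z := barrierArgmin fun i => (x i)⁻¹ + η * g i with hzdef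
  have hz : z ∈ posSimplex K := barrierArgmin_mem hK _
  have hterm : ∀ y ∈ posSimplex K, ∀ i, 0 ≤ y i / z i - 1 - Real.log (y i / z i) := fun y hy i => by
    linarith [Real.log_le_sub_one_of_pos (div_pos (hy.2 i) (hz.2 i))]
  have hmin : IsMinOn (fun y => ∑ i, y i * g i + bregman (logBarrier η) y x) (posSimplex K) z := by
    intro y hy
    have h := objective_sub_objective_argmin hK hη g hx hy
    have h0 : 0 ≤ (1 / η) * ∑ i, (y i / z i - 1 - Real.log (y i / z i)) :=
      mul_nonneg (by positivity) (Finset.sum_nonneg fun i _ => hterm y hy i)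
    simp only [Set.mem_ofPred_eq]
    simp only at h
    linarith
  obtain ⟨hm, hmmin⟩ := Classical.epsilon_spec (p := fun z => z ∈ posSimplex K ∧
    IsMinOn (fun y => ∑ i, y i * g i + bregman (logBarrier η) y x) (posSimplex K) z) ⟨z, hz, hmin⟩
  change mirrorStep η x g ∈ _ at hm
  change IsMinOn _ _ (mirrorStep η x g) at hmmin
  set m := mirrorStep η x g
  have h := objective_sub_objective_argmin hK hη g hx hm
  have hle : (1 / η) * ∑ i, (m i / z i - 1 - Real.log (m i / z i)) ≤ 0 := by
    rw [← h, sub_nonpos]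
    exact hmmin hz
  have hle' : ∑ i, (m i / z i - 1 - Real.log (m i / z i)) ≤ 0 := by
    by_contra hcon
    push Not at hcon
    have : 0 < (1 / η) * ∑ i, (m i / z i - 1 - Real.log (m i / z i)) := by positivity
    linarith
  have hzero := (Finset.sum_eq_zero_iff_of_nonneg fun i _ => hterm m hm i).1
    (le_antisymm hle' (Finset.sum_nonneg fun i _ => hterm m hm i))
  funext i
  by_contra hne
  have h1 : m i / z i ≠ 1 := fun h => hne ((div_eq_one_iff_eq (hz.2 i).ne').1 h)
  linarith [hzero i (Finset.mem_univ i),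
    Real.log_lt_sub_one_of_pos (div_pos (hm.2 i) (hz.2 i)) h1]

theorem mirrorStep_mem {K : ℕ} (hK : 0 < K) {η : ℝ} (hη : 0 < η) {x : Fin K → ℝ}
    (g : Fin K → ℝ) (hx : ∀ i, 0 < x i) : mirrorStep η x g ∈ posSimplex K := by
  rw [mirrorStep_eq_barrierArgmin hK hη g hx]
  exact barrierArgmin_mem hK _

/-- `barrierArgmin` is nonexpansive in the Euclidean norm, as the barrier `x ↦ ∑ᵢ ln (1 / xᵢ)` is
strongly convex on the simplex. -/
theorem sum_sq_barrierArgmin_sub_le {K : ℕ} (hK : 0 < K) (v v' : Fin K → ℝ) :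
    ∑ i, (barrierArgmin v i - barrierArgmin v' i) ^ 2 ≤ ∑ i, (v i - v' i) ^ 2 := by
  have hz := barrierArgmin_mem hK v
  have hz' := barrierArgmin_mem hK v'
  have hv := inv_barrierArgmin v
  have hv' := inv_barrierArgmin v'
  set z := barrierArgmin v
  set z' := barrierArgmin v'
  have hsum : ∑ i, (z i - z' i) * (normalizer v' - normalizer v) = 0 := by
    rw [← Finset.sum_mul, Finset.sum_sub_distrib, sum_eq_one_of_mem_posSimplex hz,
      sum_eq_one_of_mem_posSimplex hz']
    ring
  have key : ∀ i, (z i - z' i) ^ 2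
      ≤ (z i - z' i) * (v' i - v i) + (z i - z' i) * (normalizer v' - normalizer v) := by
    intro i
    have h1 := hz.2 i
    have h2 := hz'.2 i
    have h3 : (z i - z' i) * ((z' i)⁻¹ - (z i)⁻¹) = (z i - z' i) ^ 2 / (z i * z' i) := by
      field_simp
    have h4 : z i * z' i ≤ 1 :=
      mul_le_one₀ (le_one_of_mem_posSimplex hz i) h2.le (le_one_of_mem_posSimplex hz' i)
    have h5 : (z i - z' i) ^ 2 ≤ (z i - z' i) ^ 2 / (z i * z' i) :=
      le_div_self (sq_nonneg _) (mul_pos h1 h2) h4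
    rw [← h3, hv, hv'] at h5
    linarith
  have h1 : ∑ i, (z i - z' i) ^ 2 ≤ ∑ i, (z i - z' i) * (v' i - v i) := by
    calc _ ≤ _ := Finset.sum_le_sum fun i _ => key i
      _ = _ := by rw [Finset.sum_add_distrib, hsum, add_zero]
  have h2 : ∑ i, (z i - z' i) * (v' i - v i)
      ≤ ∑ i, ((z i - z' i) ^ 2 / 2 + (v i - v' i) ^ 2 / 2) :=
    Finset.sum_le_sum fun i _ => by nlinarith [sq_nonneg ((z i - z' i) + (v i - v' i))]
  rw [Finset.sum_add_distrib, ← Finset.sum_div, ← Finset.sum_div] at h2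
  linarith

theorem continuous_barrierArgmin {K : ℕ} (hK : 0 < K) :
    Continuous (barrierArgmin : (Fin K → ℝ) → Fin K → ℝ) := by
  refine continuous_pi fun j => continuous_iff_continuousAt.2 fun v => ?_
  refine tendsto_iff_dist_tendsto_zero.2 ?_
  have hlim : Filter.Tendsto (fun v' : Fin K → ℝ => √(∑ i, (v' i - v i) ^ 2)) (nhds v)
      (nhds 0) := by
    have : Continuous fun v' : Fin K → ℝ => √(∑ i, (v' i - v i) ^ 2) := by fun_prop
    simpa using this.tendsto v
  refine squeeze_zero (fun _ => dist_nonneg) (fun v' => ?_) hlim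
  rw [Real.dist_eq]
  refine Real.abs_le_sqrt (le_trans ?_ (sum_sq_barrierArgmin_sub_le hK v' v))
  exact Finset.single_le_sum (f := fun i => (barrierArgmin v' i - barrierArgmin v i) ^ 2)
    (fun i _ => sq_nonneg _) (Finset.mem_univ j)

/-! ### One round of mirror descent -/

/-- The Bregman divergence `D_ψ(u, x)` of the log-barrier up to a term that depends on `u` only. -/
noncomputable def potential {K : ℕ} (η : ℝ) (u x : Fin K → ℝ) : ℝ :=
  (1 / η) * ∑ i, (u i / x i + Real.log (x i))

/-- The three-point identity of mirror descent. -/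
theorem potential_mirrorStep {K : ℕ} (hK : 0 < K) {η : ℝ} (hη : 0 < η) {u x : Fin K → ℝ}
    (g : Fin K → ℝ) (hx : x ∈ posSimplex K) (hu : ∑ i, u i = 1) :
    let z := mirrorStep η x g
    ∑ i, (x i - u i) * g i + potential η u z
      = potential η u x + ∑ i, (x i - z i) * g i
        - (1 / η) * ∑ i, (z i / x i - 1 - Real.log (z i / x i)) := by
  intro z
  have hz : z ∈ posSimplex K := mirrorStep_mem hK hη g hx.2
  obtain ⟨l, hl⟩ : ∃ l, ∀ i, (z i)⁻¹ = (x i)⁻¹ + η * g i + l :=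
    ⟨_, fun i => by
      simp only [z]
      rw [mirrorStep_eq_barrierArgmin hK hη g hx.2, inv_barrierArgmin]⟩
  have hg : ∀ i, g i = (1 / η) * ((z i)⁻¹ - (x i)⁻¹ - l) := by
    intro i
    rw [hl i]
    field_simp
    ring
  have hsum : ∑ i, (u i - z i) * l = 0 := by
    rw [← Finset.sum_mul, Finset.sum_sub_distrib, hu, sum_eq_one_of_mem_posSimplex hz]
    ring
  rw [← sub_eq_zero, show (0 : ℝ) = (1 / η) * ∑ i, (u i - z i) * l by rw [hsum, mul_zero],
    potential, potential]
  simp only [Finset.mul_sum]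
  rw [← Finset.sum_add_distrib, ← Finset.sum_add_distrib, ← Finset.sum_sub_distrib,
    ← Finset.sum_sub_distrib]
  refine Finset.sum_congr rfl fun i _ => ?_
  have h1 := (hx.2 i).ne'
  have h2 := (hz.2 i).ne'
  rw [Real.log_div h2 h1, hg i]
  field_simp
  ring

/-- The stability of the log-barrier in one coordinate, `r` the ratio of the new to the old
weight. -/
theorem mul_one_sub_sub_le {s r : ℝ} (hs : -(1 / 2) ≤ s) (hr : 0 < r) :
    s * (1 - r) - (r - 1 - Real.log r) ≤ 2 * s ^ 2 := by
  have hs1 : 0 < 1 + s := by linarith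
  have h1 := Real.log_le_sub_one_of_pos (mul_pos hr hs1)
  rw [Real.log_mul hr.ne' hs1.ne'] at h1
  have h2 := Real.one_sub_inv_le_log_of_pos hs1
  have h3 : s - 2 * s ^ 2 ≤ 1 - (1 + s)⁻¹ := by
    have : 1 - (1 + s)⁻¹ - (s - 2 * s ^ 2) = s ^ 2 * (1 + 2 * s) * (1 + s)⁻¹ := by
      field_simp
      ring
    have h : 0 ≤ s ^ 2 * (1 + 2 * s) * (1 + s)⁻¹ :=
      mul_nonneg (mul_nonneg (sq_nonneg _) (by linarith)) (inv_pos.2 hs1).le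
    linarith
  nlinarith

/-- The regret of one mirror descent step on the estimated losses. The factor `8 / 162` is the
largest bias `α = 8 η` allowed; all that matters is that `(1 + 8 / 162)² ≤ 2`. -/
theorem estimator_regret_le {K : ℕ} (hK : 0 < K) {η : ℝ} (hη : 0 < η) (hη' : η ≤ 1 / 162)
    (s : State K) (hx : s.x ∈ posSimplex K) (hw : s.w ∈ posSimplex K)
    (hxw : ∀ i, s.x i ≤ (1 + 8 / 162) * s.w i) {u : Fin K → ℝ} (hu : ∑ i, u i = 1)
    (hc : s.c ∈ Set.Icc (0 : ℝ) 1) (i : Fin K) {y : ℝ} (hy : y ∈ Set.Icc (0 : ℝ) 1) :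
    ∑ j, (s.x j - u j) * s.estimator i y j + potential η u (mirrorStep η s.x (s.estimator i y))
      ≤ potential η u s.x + 4 * η * (y - s.c) ^ 2 := by
  have h := potential_mirrorStep hK hη (s.estimator i y) hx hu
  have hz := mirrorStep_mem hK hη (s.estimator i y) hx.2
  simp only at h
  rw [h]
  set z := mirrorStep η s.x (s.estimator i y)
  have hwi := hw.2 i
  have hxi := hx.2 i
  -- a multiple of the all-ones vector does not see a difference of two points of the simplex
  have h1 : ∑ j, (s.x j - z j) * s.estimator i y j = (s.x i - z i) * ((y - s.c) / s.w i) := by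
    simp only [State.estimator, mul_add, Finset.sum_add_distrib, mul_ite, mul_zero,
      Finset.sum_ite_eq', Finset.mem_univ, if_true]
    rw [← Finset.sum_mul, Finset.sum_sub_distrib, sum_eq_one_of_mem_posSimplex hx,
      sum_eq_one_of_mem_posSimplex hz]
    ring
  have hterm : ∀ j, 0 ≤ z j / s.x j - 1 - Real.log (z j / s.x j) := fun j => by
    linarith [Real.log_le_sub_one_of_pos (div_pos (hz.2 j) (hx.2 j))]
  have h2 : z i / s.x i - 1 - Real.log (z i / s.x i)
      ≤ ∑ j, (z j / s.x j - 1 - Real.log (z j / s.x j)) :=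
    Finset.single_le_sum (f := fun j => z j / s.x j - 1 - Real.log (z j / s.x j))
      (fun j _ => hterm j) (Finset.mem_univ i)
  set q := s.x i / s.w i with hq
  have hq0 : 0 < q := div_pos hxi hwi
  have hq1 : q ≤ 1 + 8 / 162 := (div_le_iff₀ hwi).2 (hxw i)
  have hd : |y - s.c| ≤ 1 := by
    rw [abs_le]
    constructor <;> linarith [hc.1, hc.2, hy.1, hy.2]
  have hs : -(1 / 2) ≤ η * q * (y - s.c) := by
    have : |η * q * (y - s.c)| ≤ 1 / 162 * (1 + 8 / 162) * 1 := by
      rw [abs_mul, abs_of_pos (mul_pos hη hq0)]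
      gcongr
    linarith [(abs_le.1 this).1]
  have h3 := mul_one_sub_sub_le hs (div_pos (hz.2 i) hxi)
  have h4 : (s.x i - z i) * ((y - s.c) / s.w i)
      = (1 / η) * (η * q * (y - s.c) * (1 - z i / s.x i)) := by
    rw [hq]
    field_simp
  have h5 : (1 / η) * (2 * (η * q * (y - s.c)) ^ 2) ≤ 4 * η * (y - s.c) ^ 2 := by
    have : (1 / η) * (2 * (η * q * (y - s.c)) ^ 2) = 2 * q ^ 2 * (η * (y - s.c) ^ 2) := by
      field_simp
    rw [this]
    have hq2 : 2 * q ^ 2 ≤ 4 := by nlinarith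
    nlinarith [mul_nonneg hη.le (sq_nonneg (y - s.c))]
  have h6 : (1 / η) * (η * q * (y - s.c) * (1 - z i / s.x i))
      - (1 / η) * ∑ j, (z j / s.x j - 1 - Real.log (z j / s.x j))
      ≤ (1 / η) * (2 * (η * q * (y - s.c)) ^ 2) := by
    rw [← mul_sub]
    exact mul_le_mul_of_nonneg_left (by linarith) (by positivity)
  rw [h1, h4]
  linarith

/-- The estimator is unbiased when the arm is drawn from `s.w`. -/
theorem sum_w_mul_estimator {K : ℕ} (s : State K) (hw : s.w ∈ posSimplex K) (v l : Fin K → ℝ) :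
    ∑ i, s.w i * ∑ j, v j * s.estimator i (l i) j = ∑ j, v j * l j := by
  simp only [Finset.mul_sum]
  rw [Finset.sum_comm]
  refine Finset.sum_congr rfl fun j _ => ?_
  have h : ∀ i, s.w i * (v j * s.estimator i (l i) j)
      = (if j = i then v j * (l i - s.c) else 0) + s.w i * (v j * s.c) := by
    intro i
    have := (hw.2 i).ne'
    rw [State.estimator]
    split_ifs with hji
    · subst hji
      field_simp
    · ring
  simp only [h]
  rw [Finset.sum_add_distrib, Finset.sum_ite_eq, if_pos (Finset.mem_univ j), ← Finset.sum_mul,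
    sum_eq_one_of_mem_posSimplex hw]
  ring

/-- One round against the loss vector `l`, in expectation over the arm: what remains beside the
regret of mirror descent is the cost `⟨w - x, l⟩` of sampling from `w` instead of `x`. -/
theorem expected_round_le {K : ℕ} (hK : 0 < K) {η : ℝ} (hη : 0 < η) (hη' : η ≤ 1 / 162)
    (s : State K) (hx : s.x ∈ posSimplex K) (hw : s.w ∈ posSimplex K)
    (hxw : ∀ i, s.x i ≤ (1 + 8 / 162) * s.w i) {u : Fin K → ℝ} (hu : ∑ i, u i = 1)
    (hc : s.c ∈ Set.Icc (0 : ℝ) 1) {l : Fin K → ℝ} (hl : ∀ i, l i ∈ Set.Icc (0 : ℝ) 1) :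
    ∑ i, s.w i * (potential η u (mirrorStep η s.x (s.estimator i (l i)))
        - 4 * η * (l i - s.c) ^ 2)
      ≤ potential η u s.x + ∑ j, u j * l j - ∑ j, s.x j * l j := by
  have h1 : ∑ i, s.w i * (∑ j, (s.x j - u j) * s.estimator i (l i) j
      + potential η u (mirrorStep η s.x (s.estimator i (l i))) - 4 * η * (l i - s.c) ^ 2)
      ≤ ∑ i, s.w i * potential η u s.x :=
    Finset.sum_le_sum fun i _ => mul_le_mul_of_nonneg_left
      (by linarith [estimator_regret_le hK hη hη' s hx hw hxw hu hc i (hl i)]) (hw.2 i).le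
  rw [← Finset.sum_mul, sum_eq_one_of_mem_posSimplex hw, one_mul] at h1
  have h2 := sum_w_mul_estimator s hw (fun j => s.x j - u j) l
  simp only [add_sub_assoc, mul_add, Finset.sum_add_distrib] at h1
  rw [h2] at h1
  simp only [sub_mul, Finset.sum_sub_distrib] at h1
  linarith

/-! ### The states of the learner -/

theorem biasFraction_mem {α y : ℝ} (hα : 0 ≤ α) (hy : y ≤ 1) :
    0 ≤ biasFraction α y ∧ biasFraction α y < 1 := by
  have h : 0 ≤ α * (1 - y) := mul_nonneg hα (by linarith)
  refine ⟨div_nonneg h (by linarith), ?_⟩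
  rw [biasFraction, div_lt_one (by linarith)]
  linarith

theorem init_mem_posSimplex {K : ℕ} (hK : 0 < K) :
    (fun _ => 1 / (K : ℝ)) ∈ posSimplex K := by
  have h : (0 : ℝ) < 1 / K := by positivity
  exact ⟨⟨fun _ => h.le, by simp [hK.ne']⟩, fun _ => h⟩

theorem run_x_mem {K : ℕ} (hK : 0 < K) {η : ℝ} (hη : 0 < η) (α : ℝ) {t : ℕ} (h : Fin t → Fin K)
    (y : Fin t → ℝ) : (run η α t h y).x ∈ posSimplex K := by
  induction t with
  | zero => exact init_mem_posSimplex hK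
  | succ t ih => exact mirrorStep_mem hK hη _ (ih _ _).2

theorem run_c_mem {K : ℕ} (η α : ℝ) {t : ℕ} (h : Fin t → Fin K) {y : Fin t → ℝ}
    (hy : ∀ s, y s ∈ Set.Icc (0 : ℝ) 1) : (run η α t h y).c ∈ Set.Icc (0 : ℝ) 1 := by
  cases t with
  | zero => simp [run, State.init]
  | succ t => exact hy _

theorem run_w_mem {K : ℕ} (hK : 0 < K) {η : ℝ} (hη : 0 < η) {α : ℝ} (hα : 0 ≤ α) {t : ℕ}
    (h : Fin t → Fin K) {y : Fin t → ℝ} (hy : ∀ s, y s ∈ Set.Icc (0 : ℝ) 1) :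
    (run η α t h y).w ∈ posSimplex K := by
  cases t with
  | zero => exact init_mem_posSimplex hK
  | succ t =>
    have hx := run_x_mem hK hη α h y
    obtain ⟨hb0, hb1⟩ := biasFraction_mem hα (hy (Fin.last t)).2
    set b := biasFraction α (y (Fin.last t))
    change (fun j => (1 - b) * (run η α (t + 1) h y).x j
      + b * (Pi.single (h (Fin.last t)) 1 : Fin K → ℝ) j) ∈ _
    have hpos : ∀ j, 0 < (1 - b) * (run η α (t + 1) h y).x j
        + b * (Pi.single (h (Fin.last t)) 1 : Fin K → ℝ) j := fun j =>
      add_pos_of_pos_of_nonneg (mul_pos (by linarith) (hx.2 j))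
        (mul_nonneg hb0 (by rw [Pi.single_apply]; split_ifs <;> norm_num))
    refine ⟨⟨fun j => (hpos j).le, ?_⟩, hpos⟩
    rw [Finset.sum_add_distrib, ← Finset.mul_sum, ← Finset.mul_sum,
      sum_eq_one_of_mem_posSimplex hx]
    simp

theorem run_x_le {K : ℕ} (hK : 0 < K) {η : ℝ} (hη : 0 < η) {α : ℝ} (hα : 0 ≤ α) {t : ℕ}
    (h : Fin t → Fin K) {y : Fin t → ℝ} (hy : ∀ s, y s ∈ Set.Icc (0 : ℝ) 1) (j : Fin K) :
    (run η α t h y).x j ≤ (1 + α) * (run η α t h y).w j := by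
  have hw := (run_w_mem hK hη hα h hy).2 j
  have hx := (run_x_mem hK hη α h y).2 j
  cases t with
  | zero =>
    change (run η α 0 h y).w j ≤ _
    nlinarith
  | succ t =>
    have hyt := hy (Fin.last t)
    set B := α * (1 - y (Fin.last t))
    have hB : 0 ≤ B := mul_nonneg hα (by linarith [hyt.2])
    have hBα : B ≤ α := mul_le_of_le_one_right hα (by linarith [hyt.1])
    have h1 : (1 + B)⁻¹ * (run η α (t + 1) h y).x j ≤ (run η α (t + 1) h y).w j := by
      change _ ≤ (1 - B / (1 + B)) * (run η α (t + 1) h y).x j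
        + B / (1 + B) * (Pi.single (h (Fin.last t)) 1 : Fin K → ℝ) j
      have h2 : 1 - B / (1 + B) = (1 + B)⁻¹ := by field_simp; ring
      rw [h2, le_add_iff_nonneg_right]
      exact mul_nonneg (by positivity) (by rw [Pi.single_apply]; split_ifs <;> norm_num)
    calc _ = (1 + B) * ((1 + B)⁻¹ * (run η α (t + 1) h y).x j) := by field_simp
      _ ≤ (1 + B) * (run η α (t + 1) h y).w j := by gcongr
      _ ≤ _ := by gcongr

/-- The loss of sampling from `w` instead of `x` after arm `p` was pulled at loss `y`. -/
theorem sum_w_sub_sum_x_step {K : ℕ} (η : ℝ) {α y : ℝ} (hα : 0 ≤ α) (hy : y ≤ 1) (s : State K)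
    (p : Fin K) (l : Fin K → ℝ) :
    ∑ j, (s.step η α p y).w j * l j - ∑ j, (s.step η α p y).x j * l j
      = α * (1 - y) * (l p - ∑ j, (s.step η α p y).w j * l j) := by
  have h0 : 0 ≤ α * (1 - y) := mul_nonneg hα (by linarith)
  have h : ∑ j, (s.step η α p y).w j * l j
      = (1 - biasFraction α y) * ∑ j, (s.step η α p y).x j * l j + biasFraction α y * l p := by
    simp only [State.step, add_mul, Finset.sum_add_distrib, mul_assoc, ← Finset.mul_sum]
    congr 2
    simp [Pi.single_apply]
  rw [h, biasFraction]
  field_simp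
  ring

namespace Adversary

variable {K : ℕ} {Ξ : Type*} [MeasurableSpace Ξ]

/-- The learner's state after it pulled the arms `h` against the adversary. -/
noncomputable def state (A : Adversary K Ξ) (η α : ℝ) (ξ : Ξ) {t : ℕ} (h : Fin t → Fin K) :
    State K :=
  run η α t h (A.observed ξ h)

theorem observed_mem (A : Adversary K Ξ) (ξ : Ξ) {t : ℕ} (h : Fin t → Fin K) (s : Fin t) :
    A.observed ξ h s ∈ Set.Icc (0 : ℝ) 1 := A.loss_mem _ _ _ _

theorem state_succ (A : Adversary K Ξ) (η α : ℝ) (ξ : Ξ) {t : ℕ} (h : Fin (t + 1) → Fin K) :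
    A.state η α ξ h = (A.state η α ξ (Fin.init h)).step η α (h (Fin.last t))
      (A.loss t (Fin.init h) ξ (h (Fin.last t))) := rfl

theorem state_snoc (A : Adversary K Ξ) (η α : ℝ) (ξ : Ξ) {t : ℕ} (h : Fin t → Fin K)
    (i : Fin K) :
    A.state η α ξ (Fin.snoc h i : Fin (t + 1) → Fin K)
      = (A.state η α ξ h).step η α i (A.loss t h ξ i) := by
  rw [state_succ, Fin.init_snoc, Fin.snoc_last]

/-- How much the loss of the last pulled arm has changed since it was pulled. Before the first round
the value is `1`, a bound for every possible change. -/
def drift (A : Adversary K Ξ) (ξ : Ξ) : (t : ℕ) → (Fin t → Fin K) → ℝ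
  | 0, _ => 1
  | t + 1, h => |A.loss (t + 1) h ξ (h (Fin.last t)) - A.loss t (Fin.init h) ξ (h (Fin.last t))|

/-- The function that decreases in expectation along the run, up to the regret and the drift. Its
quadratic term telescopes: the bias towards the last arm costs
`8 η (1 - c) (c - c') = 4 η ((1 - c') ^ 2 - (1 - c) ^ 2) - 4 η (c - c') ^ 2` when the observed loss
changes from `c` to `c'`, and the last term pays for the stability of mirror descent. -/
noncomputable def lyapunov (η : ℝ) (u : Fin K → ℝ) (s : State K) : ℝ :=
  potential η u s.x - 4 * η * (1 - s.c) ^ 2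

theorem sum_playDist_mul_lyapunov_le (hK : 0 < K) (A : Adversary K Ξ) {η : ℝ} (hη : 0 < η)
    (hη' : η ≤ 1 / 162) {u : Fin K → ℝ} (hu : ∑ i, u i = 1) (ξ : Ξ) (t : ℕ) (h : Fin t → Fin K) :
    ∑ i, A.playDist η (8 * η) ξ h i * (A.loss t h ξ i - ∑ j, u j * A.loss t h ξ j
        - 8 * η * A.drift ξ t h
        + lyapunov η u (A.state η (8 * η) ξ (Fin.snoc h i : Fin (t + 1) → Fin K)))
      ≤ lyapunov η u (A.state η (8 * η) ξ h) := by
  have hα : 0 ≤ 8 * η := by linarith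
  have hx : (A.state η (8 * η) ξ h).x ∈ posSimplex K := run_x_mem hK hη _ _ _
  have hw : (A.state η (8 * η) ξ h).w ∈ posSimplex K :=
    run_w_mem hK hη hα _ (A.observed_mem ξ h)
  have hc : (A.state η (8 * η) ξ h).c ∈ Set.Icc (0 : ℝ) 1 :=
    run_c_mem _ _ _ (A.observed_mem ξ h)
  have hxw : ∀ i, (A.state η (8 * η) ξ h).x i ≤ (1 + 8 / 162) * (A.state η (8 * η) ξ h).w i :=
    fun i => (run_x_le hK hη hα _ (A.observed_mem ξ h) i).trans
      (mul_le_mul_of_nonneg_right (by linarith) (hw.2 i).le)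
  have hl : ∀ i, A.loss t h ξ i ∈ Set.Icc (0 : ℝ) 1 := A.loss_mem t h ξ
  have hround := expected_round_le hK hη hη' _ hx hw hxw hu hc hl
  have hw1 := sum_eq_one_of_mem_posSimplex hw
  simp only [state_snoc]
  change ∑ i, (A.state η (8 * η) ξ h).w i * _ ≤ _
  set U := ∑ j, u j * A.loss t h ξ j
  set D := A.drift ξ t h with hD
  -- the change of the squared losses, split into the telescoping part and the stability term
  have hterm : ∀ i, (A.state η (8 * η) ξ h).w i * (A.loss t h ξ i - U - 8 * η * D
        + lyapunov η u ((A.state η (8 * η) ξ h).step η (8 * η) i (A.loss t h ξ i)))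
      = (A.state η (8 * η) ξ h).w i *
          (potential η u (mirrorStep η (A.state η (8 * η) ξ h).x
            ((A.state η (8 * η) ξ h).estimator i (A.loss t h ξ i)))
            - 4 * η * (A.loss t h ξ i - (A.state η (8 * η) ξ h).c) ^ 2)
        + (1 + 8 * η * (1 - (A.state η (8 * η) ξ h).c))
            * ((A.state η (8 * η) ξ h).w i * A.loss t h ξ i)
        + (A.state η (8 * η) ξ h).w i * (-U - 8 * η * D
            - 4 * η * (1 - (A.state η (8 * η) ξ h).c) ^ 2
            - 8 * η * (1 - (A.state η (8 * η) ξ h).c) * (A.state η (8 * η) ξ h).c) := by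
    intro i
    simp only [lyapunov, State.step]
    ring
  rw [Finset.sum_congr rfl fun i _ => hterm i, Finset.sum_add_distrib, Finset.sum_add_distrib,
    ← Finset.mul_sum, ← Finset.sum_mul, hw1, lyapunov]
  cases t with
  | zero =>
    have hc0 : (A.state η (8 * η) ξ h).c = 0 := rfl
    have hxw' : (A.state η (8 * η) ξ h).x = (A.state η (8 * η) ξ h).w := rfl
    have hD1 : D = 1 := rfl
    have hW : ∑ i, (A.state η (8 * η) ξ h).w i * A.loss 0 h ξ i ≤ 1 := by
      rw [← hw1]
      exact Finset.sum_le_sum fun i _ => mul_le_of_le_one_right (hw.2 i).le (hl i).2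
    rw [hxw', hc0] at hround
    rw [hxw', hc0, hD1]
    nlinarith
  | succ t =>
    set p := h (Fin.last t)
    have hcp : (A.state η (8 * η) ξ h).c = A.loss t (Fin.init h) ξ p := rfl
    have hbias : ∑ i, (A.state η (8 * η) ξ h).w i * A.loss (t + 1) h ξ i
        - ∑ i, (A.state η (8 * η) ξ h).x i * A.loss (t + 1) h ξ i
        = 8 * η * (1 - (A.state η (8 * η) ξ h).c) * (A.loss (t + 1) h ξ p
          - ∑ i, (A.state η (8 * η) ξ h).w i * A.loss (t + 1) h ξ i) :=
      sum_w_sub_sum_x_step η hα (A.loss_mem t (Fin.init h) ξ p).2 (A.state η (8 * η) ξ (Fin.init h))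
        p (A.loss (t + 1) h ξ)
    have hdD : (1 - (A.state η (8 * η) ξ h).c)
        * (A.loss (t + 1) h ξ p - (A.state η (8 * η) ξ h).c) ≤ D := by
      have hDeq : D = |A.loss (t + 1) h ξ p - (A.state η (8 * η) ξ h).c| := rfl
      rw [hDeq]
      calc _ ≤ (1 - (A.state η (8 * η) ξ h).c)
            * |A.loss (t + 1) h ξ p - (A.state η (8 * η) ξ h).c| :=
            mul_le_mul_of_nonneg_left (le_abs_self _) (by linarith [hc.2])
        _ ≤ _ := mul_le_of_le_one_left (abs_nonneg _) (by linarith [hc.1])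
    have := mul_le_mul_of_nonneg_left hdD hα
    linarith

/-! ### Expectations over the arms -/

theorem pre_snoc {t : ℕ} (h : Fin t → Fin K) (i : Fin K) (s : ℕ) (hs : s ≤ t) :
    pre (Fin.snoc h i : Fin (t + 1) → Fin K) s (Nat.le_succ_of_le hs) = pre h s hs := by
  funext r
  exact Fin.snoc_castSucc (α := fun _ => Fin K) i h (Fin.castLE hs r)

theorem pathProb_snoc (A : Adversary K Ξ) (η α : ℝ) (ξ : Ξ) {t : ℕ} (h : Fin t → Fin K)
    (i : Fin K) :
    A.pathProb η α ξ (Fin.snoc h i : Fin (t + 1) → Fin K)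
      = A.pathProb η α ξ h * A.playDist η α ξ h i := by
  rw [pathProb, Fin.prod_univ_castSucc, pathProb]
  congr 1
  · refine Finset.prod_congr rfl fun s _ => ?_
    rw [Fin.snoc_castSucc]
    exact congrArg (fun k => A.playDist η α ξ k (h s)) (pre_snoc h i s s.isLt.le)
  · rw [Fin.snoc_last]
    exact congrArg (fun k => A.playDist η α ξ k i) (pre_snoc h i t le_rfl)

theorem sum_paths_succ {t : ℕ} (f : (Fin (t + 1) → Fin K) → ℝ) :
    ∑ a, f a = ∑ h : Fin t → Fin K, ∑ i, f (Fin.snoc h i) := by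
  rw [← (Fin.snocEquiv fun _ : Fin (t + 1) => Fin K).sum_comp, Fintype.sum_prod_type,
    Finset.sum_comm]
  rfl

theorem sum_pre_snoc (g : (t : ℕ) → (Fin t → Fin K) → Fin K → ℝ) {t : ℕ} (h : Fin t → Fin K)
    (i : Fin K) :
    ∑ s : Fin (t + 1), g s (pre (Fin.snoc h i : Fin (t + 1) → Fin K) s s.isLt.le)
        ((Fin.snoc h i : Fin (t + 1) → Fin K) s)
      = ∑ s : Fin t, g s (pre h s s.isLt.le) (h s) + g t h i := by
  rw [Fin.sum_univ_castSucc]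
  congr 1
  · refine Finset.sum_congr rfl fun s _ => ?_
    rw [Fin.snoc_castSucc]
    exact congrArg (fun k => g s k (h s)) (pre_snoc h i s s.isLt.le)
  · rw [Fin.snoc_last]
    exact congrArg (fun k => g t k i) (pre_snoc h i t le_rfl)

theorem playDist_mem (hK : 0 < K) (A : Adversary K Ξ) {η α : ℝ} (hη : 0 < η) (hα : 0 ≤ α) (ξ : Ξ)
    {t : ℕ} (h : Fin t → Fin K) : A.playDist η α ξ h ∈ posSimplex K :=
  run_w_mem hK hη hα h (A.observed_mem ξ h)

theorem pathProb_nonneg (hK : 0 < K) (A : Adversary K Ξ) {η α : ℝ} (hη : 0 < η) (hα : 0 ≤ α)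
    (ξ : Ξ) {t : ℕ} (a : Fin t → Fin K) : 0 ≤ A.pathProb η α ξ a :=
  Finset.prod_nonneg fun _ _ => ((A.playDist_mem hK hη hα ξ _).2 _).le

theorem sum_pathProb (hK : 0 < K) (A : Adversary K Ξ) {η α : ℝ} (hη : 0 < η) (hα : 0 ≤ α) (ξ : Ξ)
    (t : ℕ) : ∑ a : Fin t → Fin K, A.pathProb η α ξ a = 1 := by
  induction t with
  | zero => simp [pathProb]
  | succ t ih =>
    rw [sum_paths_succ, ← ih]
    refine Finset.sum_congr rfl fun h _ => ?_
    simp only [pathProb_snoc]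
    rw [← Finset.mul_sum, sum_eq_one_of_mem_posSimplex (A.playDist_mem hK hη hα ξ h), mul_one]

/-- The supermartingale argument: if `Ψ` drops by at least the increment `g` in each round in
expectation over the arm of that round, then it does so over the whole run. -/
theorem sum_pathProb_mul_le (hK : 0 < K) (A : Adversary K Ξ) {η α : ℝ} (hη : 0 < η) (hα : 0 ≤ α)
    (ξ : Ξ) (g : (t : ℕ) → (Fin t → Fin K) → Fin K → ℝ) (Ψ : (t : ℕ) → (Fin t → Fin K) → ℝ)
    (hstep : ∀ t (h : Fin t → Fin K),
      ∑ i, A.playDist η α ξ h i * (g t h i + Ψ (t + 1) (Fin.snoc h i)) ≤ Ψ t h) (T : ℕ) :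
    ∑ a : Fin T → Fin K, A.pathProb η α ξ a
      * (∑ s : Fin T, g s (pre a s s.isLt.le) (a s) + Ψ T a) ≤ Ψ 0 Fin.elim0 := by
  induction T with
  | zero => simp [pathProb, Subsingleton.elim (default : Fin 0 → Fin K) Fin.elim0]
  | succ T ih =>
    refine le_trans ?_ ih
    rw [sum_paths_succ]
    refine Finset.sum_le_sum fun h _ => ?_
    have h1 : ∀ i, A.pathProb η α ξ (Fin.snoc h i : Fin (T + 1) → Fin K)
          * (∑ s : Fin (T + 1), g s (pre (Fin.snoc h i : Fin (T + 1) → Fin K) s s.isLt.le)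
            ((Fin.snoc h i : Fin (T + 1) → Fin K) s) + Ψ (T + 1) (Fin.snoc h i))
        = A.pathProb η α ξ h * (A.playDist η α ξ h i * ∑ s : Fin T, g s (pre h s s.isLt.le) (h s)
          + A.playDist η α ξ h i * (g T h i + Ψ (T + 1) (Fin.snoc h i))) := by
      intro i
      rw [sum_pre_snoc, pathProb_snoc]
      ring
    rw [Finset.sum_congr rfl fun i _ => h1 i, ← Finset.mul_sum, Finset.sum_add_distrib,
      ← Finset.sum_mul, sum_eq_one_of_mem_posSimplex (A.playDist_mem hK hη hα ξ h), one_mul]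
    exact mul_le_mul_of_nonneg_left (by linarith [hstep T h]) (A.pathProb_nonneg hK hη hα ξ h)

end Adversary

/-! ### Measurability in the adversary's randomness and continuity in the learning rate -/

theorem measurable_run {K : ℕ} (hK : 0 < K) {η : ℝ} (hη : 0 < η) (α : ℝ) {t : ℕ}
    (h : Fin t → Fin K) :
    (∀ j, Measurable fun y => (run η α t h y).x j) ∧
      (∀ j, Measurable fun y => (run η α t h y).w j) ∧ Measurable fun y => (run η α t h y).c := by
  induction t with
  | zero => exact ⟨fun _ => measurable_const, fun _ => measurable_const, measurable_const⟩
  | succ t ih =>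
    obtain ⟨ihx, ihw, ihc⟩ := ih (Fin.init h)
    have hinit : Measurable fun y : Fin (t + 1) → ℝ => (Fin.init y : Fin t → ℝ) :=
      measurable_pi_lambda _ fun s => measurable_pi_apply s.castSucc
    have hy : Measurable fun y : Fin (t + 1) → ℝ => y (Fin.last t) := measurable_pi_apply _
    have hest : ∀ j, Measurable fun y : Fin (t + 1) → ℝ =>
        (run η α t (Fin.init h) (Fin.init y)).estimator (h (Fin.last t)) (y (Fin.last t)) j := by
      intro j
      have hc := ihc.comp hinit
      refine Measurable.add ?_ hc
      split_ifs
      · exact (hy.sub hc).div ((ihw j).comp hinit)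
      · exact measurable_const
    have hx : ∀ j, Measurable fun y => (run η α (t + 1) h y).x j := by
      intro j
      have heq : (fun y => (run η α (t + 1) h y).x j) = fun y => barrierArgmin (fun i =>
          ((run η α t (Fin.init h) (Fin.init y)).x i)⁻¹ + η *
            (run η α t (Fin.init h) (Fin.init y)).estimator (h (Fin.last t)) (y (Fin.last t)) i)
          j := by
        funext y
        exact congrFun (mirrorStep_eq_barrierArgmin hK hη _ (run_x_mem hK hη α _ _).2) j
      rw [heq]
      exact (measurable_pi_apply j).comp ((continuous_barrierArgmin hK).measurable.comp
        (measurable_pi_lambda _ fun i => ((ihx i).comp hinit).inv.add ((hest i).const_mul η)))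
    refine ⟨hx, fun j => ?_, hy⟩
    have hb : Measurable fun y : Fin (t + 1) → ℝ => biasFraction α (y (Fin.last t)) := by
      unfold biasFraction
      fun_prop
    exact ((measurable_const.sub hb).mul (hx j)).add (hb.mul measurable_const)

theorem continuousOn_run {K : ℕ} (hK : 0 < K) {t : ℕ} (h : Fin t → Fin K) {y : Fin t → ℝ}
    (hy : ∀ s, y s ∈ Set.Icc (0 : ℝ) 1) :
    (∀ j, ContinuousOn (fun η : ℝ => (run η (8 * η) t h y).x j) (Set.Ioi 0)) ∧
      (∀ j, ContinuousOn (fun η : ℝ => (run η (8 * η) t h y).w j) (Set.Ioi 0)) ∧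
      ContinuousOn (fun η : ℝ => (run η (8 * η) t h y).c) (Set.Ioi 0) := by
  induction t with
  | zero => exact ⟨fun _ => continuousOn_const, fun _ => continuousOn_const, continuousOn_const⟩
  | succ t ih =>
    have hyi : ∀ s, (Fin.init y : Fin t → ℝ) s ∈ Set.Icc (0 : ℝ) 1 := fun s => hy s.castSucc
    obtain ⟨ihx, ihw, ihc⟩ := ih (Fin.init h) hyi
    have hest : ∀ j, ContinuousOn (fun η : ℝ => (run η (8 * η) t (Fin.init h)
        (Fin.init y)).estimator (h (Fin.last t)) (y (Fin.last t)) j) (Set.Ioi 0) := by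
      intro j
      refine ContinuousOn.add ?_ ihc
      split_ifs
      · exact (continuousOn_const.sub ihc).div (ihw j) fun η hη =>
          ((run_w_mem hK hη (by linarith [Set.mem_Ioi.1 hη]) _ hyi).2 j).ne'
      · exact continuousOn_const
    have hx : ∀ j, ContinuousOn (fun η : ℝ => (run η (8 * η) (t + 1) h y).x j) (Set.Ioi 0) := by
      intro j
      have hcont : ContinuousOn (fun η : ℝ => barrierArgmin (fun i =>
          ((run η (8 * η) t (Fin.init h) (Fin.init y)).x i)⁻¹ + η *
            (run η (8 * η) t (Fin.init h) (Fin.init y)).estimator (h (Fin.last t))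
              (y (Fin.last t)) i) j) (Set.Ioi 0) := by
        exact ((continuous_apply j).comp (continuous_barrierArgmin hK)).comp_continuousOn
          (continuousOn_pi.2 fun i => ((ihx i).inv₀ fun η hη =>
            ((run_x_mem hK hη _ _ _).2 i).ne').add (continuousOn_id.mul (hest i)))
      refine hcont.congr fun η hη => ?_
      exact congrFun (mirrorStep_eq_barrierArgmin hK hη _ (run_x_mem hK hη _ _ _).2) j
    refine ⟨hx, fun j => ?_, continuousOn_const⟩
    have hb : ContinuousOn (fun η : ℝ => biasFraction (8 * η) (y (Fin.last t))) (Set.Ioi 0) := by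
      unfold biasFraction
      refine ContinuousOn.div (by fun_prop) (by fun_prop) fun η hη => ?_
      have : 0 ≤ 8 * η * (1 - y (Fin.last t)) :=
        mul_nonneg (by linarith [Set.mem_Ioi.1 hη]) (by linarith [(hy (Fin.last t)).2])
      positivity
    exact ((continuousOn_const.sub hb).mul (hx j)).add (hb.mul continuousOn_const)

namespace Adversary

variable {K : ℕ} {Ξ : Type*} [MeasurableSpace Ξ]

theorem measurable_pathProb (hK : 0 < K) (A : Adversary K Ξ) {η : ℝ} (hη : 0 < η) (α : ℝ) {t : ℕ}
    (a : Fin t → Fin K) : Measurable fun ξ => A.pathProb η α ξ a := by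
  refine Finset.measurable_fun_prod _ fun s _ => ?_
  refine ((measurable_run hK hη α (pre a s s.isLt.le)).2.1 (a s)).comp ?_
  exact measurable_pi_lambda _ fun r => (measurable_pi_apply _).comp (A.measurable_loss _ _)

theorem continuousOn_pathProb (hK : 0 < K) (A : Adversary K Ξ) (ξ : Ξ) {t : ℕ}
    (a : Fin t → Fin K) : ContinuousOn (fun η => A.pathProb η (8 * η) ξ a) (Set.Ioi 0) :=
  continuousOn_finsetProd _ fun s _ =>
    (continuousOn_run hK (pre a s s.isLt.le) (A.observed_mem ξ _)).2.1 (a s)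

end Adversary

/-! ### The regret bound for a fixed learning rate -/

/-- The divergence of a comparator with all weights at least `1 / (T K)` from the uniform
distribution. -/
theorem potential_init_sub_le {K : ℕ} (hK : 0 < K) {T : ℕ} (hT : 0 < T) {η : ℝ} (hη : 0 < η)
    {u x : Fin K → ℝ} (hu : ∑ i, u i = 1) (hu' : ∀ i, 1 / ((T : ℝ) * K) ≤ u i)
    (hx : x ∈ posSimplex K) :
    potential η u (fun _ => 1 / (K : ℝ)) - potential η u x ≤ K * Real.log T / η := by
  have hK' : (0 : ℝ) < K := by exact_mod_cast hK
  have hT' : (0 : ℝ) < T := by exact_mod_cast hT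
  have hterm : ∀ i, u i / (1 / (K : ℝ)) + Real.log (1 / K) - (u i / x i + Real.log (x i))
      ≤ u i * K - 1 + Real.log T := by
    intro i
    have hui : 0 < u i := lt_of_lt_of_le (by positivity) (hu' i)
    have h1 := Real.log_le_sub_one_of_pos (div_pos hui (hx.2 i))
    rw [Real.log_div hui.ne' (hx.2 i).ne'] at h1
    have h2 := Real.log_le_log (by positivity) (hu' i)
    rw [one_div, Real.log_inv, Real.log_mul hT'.ne' hK'.ne'] at h2
    rw [one_div, Real.log_inv, div_inv_eq_mul]
    linarith
  have hsum : ∑ i : Fin K, (u i * (K : ℝ) - 1 + Real.log T) = K * Real.log T := by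
    rw [Finset.sum_add_distrib, Finset.sum_sub_distrib, ← Finset.sum_mul, hu]
    simp
  rw [potential, potential, ← mul_sub, ← Finset.sum_sub_distrib, one_div_mul_eq_div]
  gcongr
  rw [← hsum]
  exact Finset.sum_le_sum fun i _ => hterm i

namespace Adversary

variable {K : ℕ} {Ξ : Type*} [MeasurableSpace Ξ]

/-- The regret against arm `i` along the arms `a`. -/
def regretOn (A : Adversary K Ξ) (i : Fin K) (ξ : Ξ) {T : ℕ} (a : Fin T → Fin K) : ℝ :=
  ∑ t : Fin T, A.lossVec ξ a (t + 1) t.isLt (a t) - ∑ t : Fin T, A.lossVec ξ a (t + 1) t.isLt i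

/-- The variation of the losses of the pulled arms along the arms `a`. -/
def pulledVariationOn (A : Adversary K Ξ) (ξ : Ξ) {T : ℕ} (a : Fin T → Fin K) : ℝ :=
  ∑ t : Fin (T - 1), |A.lossVec ξ a (t + 2) (by omega) (a ⟨t, by omega⟩)
    - A.lossVec ξ a (t + 1) (by omega) (a ⟨t, by omega⟩)|

/-- The max-norm path-length along the arms `a`. -/
noncomputable def maxPathLengthOn (A : Adversary K Ξ) (ξ : Ξ) {T : ℕ} (a : Fin T → Fin K) : ℝ :=
  ∑ t : Fin T, ‖A.lossVec ξ a (t + 1) t.isLt - A.lossVec ξ a t t.isLt.le‖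

theorem lossVec_mem (A : Adversary K Ξ) (ξ : Ξ) {T : ℕ} (a : Fin T → Fin K) (t : ℕ) (ht : t ≤ T)
    (i : Fin K) : A.lossVec ξ a t ht i ∈ Set.Icc (0 : ℝ) 1 := by
  cases t with
  | zero => simp [lossVec]
  | succ t => exact A.loss_mem _ _ _ _

theorem sum_drift (A : Adversary K Ξ) (ξ : Ξ) {T : ℕ} (hT : 0 < T) (a : Fin T → Fin K) :
    ∑ t : Fin T, A.drift ξ t (pre a t t.isLt.le) = 1 + A.pulledVariationOn ξ a := by
  obtain ⟨n, rfl⟩ : ∃ n, T = n + 1 := ⟨T - 1, by omega⟩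
  rw [Fin.sum_univ_succ]
  rfl

theorem pulledVariationOn_le (A : Adversary K Ξ) (ξ : Ξ) {T : ℕ} (a : Fin T → Fin K) :
    A.pulledVariationOn ξ a ≤ A.maxPathLengthOn ξ a := by
  cases T with
  | zero => simp [pulledVariationOn, maxPathLengthOn]
  | succ n =>
    rw [maxPathLengthOn, Fin.sum_univ_succ]
    refine le_trans ?_ (le_add_of_nonneg_left (norm_nonneg _))
    exact Finset.sum_le_sum fun t _ => norm_le_pi_norm
      (A.lossVec ξ a (t + 2) (by omega) - A.lossVec ξ a (t + 1) (by omega)) (a t.castSucc)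

theorem maxPathLengthOn_nonneg (A : Adversary K Ξ) (ξ : Ξ) {T : ℕ} (a : Fin T → Fin K) :
    0 ≤ A.maxPathLengthOn ξ a := Finset.sum_nonneg fun _ _ => norm_nonneg _

theorem maxPathLengthOn_le (A : Adversary K Ξ) (ξ : Ξ) {T : ℕ} (a : Fin T → Fin K) :
    A.maxPathLengthOn ξ a ≤ T := by
  calc A.maxPathLengthOn ξ a ≤ ∑ _t : Fin T, (1 : ℝ) := by
        refine Finset.sum_le_sum fun t _ => (pi_norm_le_iff_of_nonneg zero_le_one).2 fun i => ?_
        have h1 := A.lossVec_mem ξ a (t + 1) t.isLt i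
        have h2 := A.lossVec_mem ξ a t t.isLt.le i
        rw [Pi.sub_apply, Real.norm_eq_abs, abs_le]
        constructor <;> linarith [h1.1, h1.2, h2.1, h2.2]
    _ = T := by simp

theorem pulledVariationOn_nonneg (A : Adversary K Ξ) (ξ : Ξ) {T : ℕ} (a : Fin T → Fin K) :
    0 ≤ A.pulledVariationOn ξ a := Finset.sum_nonneg fun _ _ => abs_nonneg _

theorem abs_regretOn_le (A : Adversary K Ξ) (i : Fin K) (ξ : Ξ) {T : ℕ} (a : Fin T → Fin K) :
    |A.regretOn i ξ a| ≤ T := by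
  rw [regretOn, ← Finset.sum_sub_distrib]
  refine (Finset.abs_sum_le_sum_abs _ _).trans ?_
  calc _ ≤ ∑ _t : Fin T, (1 : ℝ) := by
        refine Finset.sum_le_sum fun t _ => ?_
        have h1 := A.lossVec_mem ξ a (t + 1) t.isLt i
        have h2 := A.lossVec_mem ξ a (t + 1) t.isLt (a t)
        rw [abs_le]
        constructor <;> linarith [h1.1, h1.2, h2.1, h2.2]
    _ = T := by simp

/-- The regret against arm `i` for a fixed value of the adversary's randomness. The comparator is
arm `i` mixed with a fraction `1 / T` of the uniform distribution, at which the log-barrier is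
finite. -/
theorem sum_pathProb_mul_regretOn_le (hK : 0 < K) (A : Adversary K Ξ) {η : ℝ} (hη : 0 < η)
    (hη' : η ≤ 1 / 162) {T : ℕ} (hT : 2 ≤ T) (i : Fin K) (ξ : Ξ) :
    ∑ a : Fin T → Fin K, A.pathProb η (8 * η) ξ a * A.regretOn i ξ a
      ≤ 2 * (K * Real.log T / η)
        + 8 * η * ∑ a : Fin T → Fin K, A.pathProb η (8 * η) ξ a * A.pulledVariationOn ξ a := by
  have hα : 0 ≤ 8 * η := by linarith
  have hK1 : (1 : ℝ) ≤ K := by exact_mod_cast hK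
  have hT2 : (2 : ℝ) ≤ T := by exact_mod_cast hT
  have hT0 : (0 : ℝ) < T := by linarith
  set u : Fin K → ℝ := fun j =>
    (1 - 1 / (T : ℝ)) * (if j = i then 1 else 0) + 1 / (T * K) with hu_def
  have hT1 : 1 / (T : ℝ) ≤ 1 := by
    rw [div_le_one hT0]
    linarith
  have hu : ∑ j, u j = 1 := by
    simp only [hu_def, Finset.sum_add_distrib, ← Finset.mul_sum, Finset.sum_ite_eq',
      Finset.mem_univ, if_true]
    simp
    field_simp
    ring
  have hu' : ∀ j, 1 / ((T : ℝ) * K) ≤ u j := fun j =>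
    le_add_of_nonneg_left (mul_nonneg (by linarith) (by split_ifs <;> norm_num))
  have huloss : ∀ l : Fin K → ℝ, (∀ j, l j ∈ Set.Icc (0 : ℝ) 1) →
      ∑ j, u j * l j ≤ l i + 1 / T := by
    intro l hl
    have h1 : ∑ j, u j * l j = (1 - 1 / (T : ℝ)) * l i + ∑ j, 1 / ((T : ℝ) * K) * l j := by
      simp only [hu_def, add_mul, Finset.sum_add_distrib]
      simp
    have h2 : ∑ j, 1 / ((T : ℝ) * K) * l j ≤ ∑ _j : Fin K, 1 / ((T : ℝ) * K) :=
      Finset.sum_le_sum fun j _ => mul_le_of_le_one_right (by positivity) (hl j).2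
    have h3 : ∑ _j : Fin K, 1 / ((T : ℝ) * K) = 1 / T := by
      simp
      field_simp
    have h4 : (1 - 1 / (T : ℝ)) * l i ≤ l i :=
      mul_le_of_le_one_left (hl i).1 (by linarith [one_div_pos.2 hT0])
    linarith
  have hsuper := A.sum_pathProb_mul_le hK hη hα ξ
    (fun t h j => A.loss t h ξ j - ∑ k, u k * A.loss t h ξ k - 8 * η * A.drift ξ t h)
    (fun t h => lyapunov η u (A.state η (8 * η) ξ h))
    (fun t h => A.sum_playDist_mul_lyapunov_le hK hη hη' hu ξ t h) T
  set Φ := potential η u fun _ => 1 / (K : ℝ)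
  have hinit : lyapunov η u (A.state η (8 * η) ξ (Fin.elim0 : Fin 0 → Fin K)) = Φ - 4 * η := by
    change Φ - 4 * η * (1 - 0) ^ 2 = _
    ring
  rw [hinit] at hsuper
  have hpath : ∀ a : Fin T → Fin K, A.regretOn i ξ a - 1 - 8 * η * (1 + A.pulledVariationOn ξ a)
        + (Φ - K * Real.log T / η - 4 * η)
      ≤ ∑ s : Fin T, (A.loss s (pre a s s.isLt.le) ξ (a s)
          - ∑ k, u k * A.loss s (pre a s s.isLt.le) ξ k - 8 * η * A.drift ξ s (pre a s s.isLt.le))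
        + lyapunov η u (A.state η (8 * η) ξ a) := by
    intro a
    have h1 : Φ - K * Real.log T / η - 4 * η ≤ lyapunov η u (A.state η (8 * η) ξ a) := by
      have hx : (A.state η (8 * η) ξ a).x ∈ posSimplex K := run_x_mem hK hη _ _ _
      have hc : (A.state η (8 * η) ξ a).c ∈ Set.Icc (0 : ℝ) 1 :=
        run_c_mem _ _ _ (A.observed_mem ξ a)
      have h2 := potential_init_sub_le hK (by omega) hη hu hu' hx
      have h3 : (1 - (A.state η (8 * η) ξ a).c) ^ 2 ≤ 1 :=
        pow_le_one₀ (by linarith [hc.2]) (by linarith [hc.1])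
      rw [lyapunov]
      nlinarith
    have h2 : ∑ s : Fin T, ∑ k, u k * A.loss s (pre a s s.isLt.le) ξ k
        ≤ ∑ s : Fin T, A.lossVec ξ a (s + 1) s.isLt i + 1 := by
      calc _ ≤ ∑ s : Fin T, (A.lossVec ξ a (s + 1) s.isLt i + 1 / T) :=
            Finset.sum_le_sum fun s _ => huloss _ (A.loss_mem _ _ ξ)
        _ = _ := by
            rw [Finset.sum_add_distrib]
            simp [hT0.ne']
    have h3 : A.regretOn i ξ a = ∑ s : Fin T, A.loss s (pre a s s.isLt.le) ξ (a s)
        - ∑ s : Fin T, A.lossVec ξ a (s + 1) s.isLt i := rfl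
    rw [Finset.sum_sub_distrib, Finset.sum_sub_distrib, ← Finset.mul_sum,
      A.sum_drift ξ (by omega) a, h3]
    linarith
  have hsum := (Finset.sum_le_sum fun a _ =>
    mul_le_mul_of_nonneg_left (hpath a) (A.pathProb_nonneg hK hη hα ξ a)).trans hsuper
  have hsplit : ∑ a : Fin T → Fin K, A.pathProb η (8 * η) ξ a * (A.regretOn i ξ a - 1
        - 8 * η * (1 + A.pulledVariationOn ξ a) + (Φ - K * Real.log T / η - 4 * η))
      = ∑ a : Fin T → Fin K, A.pathProb η (8 * η) ξ a * A.regretOn i ξ a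
        - 8 * η * ∑ a : Fin T → Fin K, A.pathProb η (8 * η) ξ a * A.pulledVariationOn ξ a
        + (Φ - K * Real.log T / η - 12 * η - 1) := by
    have hone : Φ - K * Real.log T / η - 12 * η - 1 = ∑ a : Fin T → Fin K,
        A.pathProb η (8 * η) ξ a * (Φ - K * Real.log T / η - 12 * η - 1) := by
      rw [← Finset.sum_mul, A.sum_pathProb hK hη hα ξ T, one_mul]
    rw [hone, Finset.mul_sum, ← Finset.sum_sub_distrib, ← Finset.sum_add_distrib]
    exact Finset.sum_congr rfl fun a _ => by ring
  rw [hsplit] at hsum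
  -- the lower-order terms are absorbed by the divergence term, which is at least `162 ln 2`
  have hlog : 2 ≤ K * Real.log T / η := by
    have h1 : Real.log 2 ≤ Real.log T := Real.log_le_log (by norm_num) hT2
    have h2 := Real.log_two_gt_d9
    rw [le_div_iff₀ hη]
    nlinarith
  linarith

/-! ### Expectations over the adversary's randomness -/

theorem measurable_lossVec (A : Adversary K Ξ) {T : ℕ} (a : Fin T → Fin K) (t : ℕ) (ht : t ≤ T) :
    Measurable fun ξ => A.lossVec ξ a t ht := by
  cases t with
  | zero => exact measurable_const
  | succ t => exact A.measurable_loss _ _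

theorem measurable_lossVec_apply (A : Adversary K Ξ) {T : ℕ} (a : Fin T → Fin K) (t : ℕ)
    (ht : t ≤ T) (i : Fin K) : Measurable fun ξ => A.lossVec ξ a t ht i :=
  (measurable_pi_apply i).comp (A.measurable_lossVec a t ht)

theorem measurable_regretOn (A : Adversary K Ξ) (i : Fin K) {T : ℕ} (a : Fin T → Fin K) :
    Measurable fun ξ => A.regretOn i ξ a :=
  (Finset.measurable_fun_sum _ fun _ _ => A.measurable_lossVec_apply a _ _ _).sub
    (Finset.measurable_fun_sum _ fun _ _ => A.measurable_lossVec_apply a _ _ _)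

theorem measurable_pulledVariationOn (A : Adversary K Ξ) {T : ℕ} (a : Fin T → Fin K) :
    Measurable fun ξ => A.pulledVariationOn ξ a :=
  Finset.measurable_fun_sum _ fun _ _ => measurable_abs.comp
    ((A.measurable_lossVec_apply a _ _ _).sub (A.measurable_lossVec_apply a _ _ _))

theorem measurable_maxPathLengthOn (A : Adversary K Ξ) {T : ℕ} (a : Fin T → Fin K) :
    Measurable fun ξ => A.maxPathLengthOn ξ a :=
  Finset.measurable_fun_sum _ fun _ _ =>
    ((A.measurable_lossVec a _ _).sub (A.measurable_lossVec a _ _)).norm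

theorem measurable_sum_pathProb_mul (hK : 0 < K) (A : Adversary K Ξ) {η : ℝ} (hη : 0 < η) (α : ℝ)
    {T : ℕ} {f : Ξ → (Fin T → Fin K) → ℝ} (hf : ∀ a, Measurable fun ξ => f ξ a) :
    Measurable fun ξ => ∑ a, A.pathProb η α ξ a * f ξ a :=
  Finset.measurable_fun_sum _ fun a _ => (A.measurable_pathProb hK hη α a).mul (hf a)

theorem norm_sum_pathProb_mul_le (hK : 0 < K) (A : Adversary K Ξ) {η α : ℝ} (hη : 0 < η)
    (hα : 0 ≤ α) {T : ℕ} {f : (Fin T → Fin K) → ℝ} {B : ℝ} (hB : ∀ a, |f a| ≤ B) (ξ : Ξ) :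
    ‖∑ a, A.pathProb η α ξ a * f a‖ ≤ B := by
  calc _ ≤ ∑ a, A.pathProb η α ξ a * B := by
        refine norm_sum_le_of_le _ fun a _ => ?_
        have h0 := A.pathProb_nonneg hK hη hα ξ a
        rw [norm_mul, Real.norm_of_nonneg h0]
        exact mul_le_mul_of_nonneg_left (hB a) h0
    _ = B := by rw [← Finset.sum_mul, A.sum_pathProb hK hη hα ξ T, one_mul]

theorem integrable_sum_pathProb_mul (hK : 0 < K) (A : Adversary K Ξ) (P : Measure Ξ)
    [IsProbabilityMeasure P] {η α : ℝ} (hη : 0 < η) (hα : 0 ≤ α) {T : ℕ}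
    {f : Ξ → (Fin T → Fin K) → ℝ} (hf : ∀ a, Measurable fun ξ => f ξ a) {B : ℝ}
    (hB : ∀ ξ a, |f ξ a| ≤ B) : Integrable (fun ξ => ∑ a, A.pathProb η α ξ a * f ξ a) P :=
  Integrable.of_bound (A.measurable_sum_pathProb_mul hK hη α hf).aestronglyMeasurable B
    (Filter.Eventually.of_forall fun ξ => A.norm_sum_pathProb_mul_le hK hη hα (hB ξ) ξ)

theorem abs_maxPathLengthOn_le (A : Adversary K Ξ) (ξ : Ξ) {T : ℕ} (a : Fin T → Fin K) :
    |A.maxPathLengthOn ξ a| ≤ T := by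
  rw [abs_of_nonneg (A.maxPathLengthOn_nonneg ξ a)]
  exact A.maxPathLengthOn_le ξ a

theorem abs_pulledVariationOn_le (A : Adversary K Ξ) (ξ : Ξ) {T : ℕ} (a : Fin T → Fin K) :
    |A.pulledVariationOn ξ a| ≤ T := by
  rw [abs_of_nonneg (A.pulledVariationOn_nonneg ξ a)]
  exact (A.pulledVariationOn_le ξ a).trans (A.maxPathLengthOn_le ξ a)

theorem pulledVariation_le_maxPathLength (hK : 0 < K) (A : Adversary K Ξ) (P : Measure Ξ)
    [IsProbabilityMeasure P] (T : ℕ) {η α : ℝ} (hη : 0 < η) (hα : 0 ≤ α) :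
    A.pulledVariation P T η α ≤ A.maxPathLength P T η α :=
  integral_mono
    (A.integrable_sum_pathProb_mul hK P hη hα A.measurable_pulledVariationOn
      fun ξ a => A.abs_pulledVariationOn_le ξ a)
    (A.integrable_sum_pathProb_mul hK P hη hα A.measurable_maxPathLengthOn
      fun ξ a => A.abs_maxPathLengthOn_le ξ a)
    fun ξ => Finset.sum_le_sum fun a _ =>
      mul_le_mul_of_nonneg_left (A.pulledVariationOn_le ξ a) (A.pathProb_nonneg hK hη hα ξ a)

theorem pulledVariation_nonneg (hK : 0 < K) (A : Adversary K Ξ) (P : Measure Ξ) (T : ℕ) {η α : ℝ}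
    (hη : 0 < η) (hα : 0 ≤ α) : 0 ≤ A.pulledVariation P T η α :=
  integral_nonneg fun ξ => Finset.sum_nonneg fun a _ =>
    mul_nonneg (A.pathProb_nonneg hK hη hα ξ a) (A.pulledVariationOn_nonneg ξ a)

theorem maxPathLength_nonneg (hK : 0 < K) (A : Adversary K Ξ) (P : Measure Ξ) (T : ℕ) {η α : ℝ}
    (hη : 0 < η) (hα : 0 ≤ α) : 0 ≤ A.maxPathLength P T η α :=
  integral_nonneg fun ξ => Finset.sum_nonneg fun a _ =>
    mul_nonneg (A.pathProb_nonneg hK hη hα ξ a) (A.maxPathLengthOn_nonneg ξ a)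

theorem maxPathLength_le (hK : 0 < K) (A : Adversary K Ξ) (P : Measure Ξ)
    [IsProbabilityMeasure P] (T : ℕ) {η α : ℝ} (hη : 0 < η) (hα : 0 ≤ α) :
    A.maxPathLength P T η α ≤ T := by
  have h := norm_integral_le_of_norm_le_const (μ := P) (Filter.Eventually.of_forall fun ξ =>
    A.norm_sum_pathProb_mul_le hK hη hα (T := T) (A.abs_maxPathLengthOn_le ξ) ξ)
  rw [probReal_univ, mul_one] at h
  exact (le_abs_self _).trans h

theorem continuousOn_maxPathLength (hK : 0 < K) (A : Adversary K Ξ) (P : Measure Ξ)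
    [IsProbabilityMeasure P] (T : ℕ) :
    ContinuousOn (fun η => A.maxPathLength P T η (8 * η)) (Set.Ioi 0) := by
  refine continuousOn_of_dominated (bound := fun _ => (T : ℝ)) (fun η hη => ?_) (fun η hη => ?_)
    (integrable_const _) ?_
  · exact (A.measurable_sum_pathProb_mul hK hη _ A.measurable_maxPathLengthOn).aestronglyMeasurable
  · exact Filter.Eventually.of_forall fun ξ => A.norm_sum_pathProb_mul_le hK hη
      (by linarith [Set.mem_Ioi.1 hη]) (A.abs_maxPathLengthOn_le ξ) ξ
  · exact Filter.Eventually.of_forall fun ξ => continuousOn_finsetSum _ fun a _ =>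
      (A.continuousOn_pathProb hK ξ a).mul continuousOn_const

/-- With a single arm there is no regret. -/
theorem regret_one_arm (A : Adversary 1 Ξ) (P : Measure Ξ) (T : ℕ) (η α : ℝ) :
    A.regret P T η α = 0 := by
  have h : ∀ i : Fin 1, (A.expect P η α fun ξ (a : Fin T → Fin 1) =>
      ∑ t : Fin T, A.lossVec ξ a (t + 1) t.isLt (a t)
        - ∑ t : Fin T, A.lossVec ξ a (t + 1) t.isLt i) = 0 := by
    intro i
    simp [expect, fun j : Fin 1 => Subsingleton.elim j i]
  simp only [regret, h, ciSup_const]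

theorem regret_le (hK : 0 < K) {T : ℕ} (hKT : K ≤ T) (A : Adversary K Ξ) (P : Measure Ξ)
    [IsProbabilityMeasure P] {η : ℝ} (hη : 0 < η) (hη' : η ≤ 1 / 162) :
    A.regret P T η (8 * η)
      ≤ 8 * (K * Real.log T / η + η * A.pulledVariation P T η (8 * η)) := by
  have hα : 0 ≤ 8 * η := by linarith
  have hpv := A.pulledVariation_nonneg hK P T hη hα
  have hlog : 0 ≤ K * Real.log T / η :=
    div_nonneg (mul_nonneg K.cast_nonneg (Real.log_natCast_nonneg T)) hη.le
  rcases Nat.lt_or_ge T 2 with hT | hT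
  · obtain rfl : K = 1 := by omega
    rw [regret_one_arm]
    positivity
  have : Nonempty (Fin K) := ⟨⟨0, hK⟩⟩
  refine ciSup_le fun i => ?_
  have hint := (A.integrable_sum_pathProb_mul hK P hη hα (T := T) A.measurable_pulledVariationOn
    fun ξ a => A.abs_pulledVariationOn_le ξ a).const_mul (8 * η)
  have h := integral_mono (μ := P)
    (A.integrable_sum_pathProb_mul hK P hη hα (T := T) (A.measurable_regretOn i)
      fun ξ a => A.abs_regretOn_le i ξ a)
    ((integrable_const (2 * (K * Real.log T / η))).add hint)
    (fun ξ => A.sum_pathProb_mul_regretOn_le hK hη hη' hT i ξ)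
  rw [integral_add' (integrable_const _) hint, integral_const, integral_const_mul, probReal_univ,
    one_smul] at h
  refine le_trans h ?_
  change 2 * (K * Real.log T / η) + 8 * η * A.pulledVariation P T η (8 * η) ≤ _
  linarith

end Adversary

/-! ### Tuning the learning rate -/

/-- The bound for a learning rate that balances its two terms, or for the largest learning rate
when the balancing one is larger. -/
theorem tuned_bound {R L V η : ℝ} (hL : 0 ≤ L) (hV : 0 ≤ V) (hη : 0 < η)
    (hR : R ≤ 8 * (L / η + η * V)) (h : η = 1 / 162 ∧ V ≤ 162 ^ 2 * L ∨ η ^ 2 * V = L) :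
    R ≤ 1296 * (√(V * L) + L) := by
  have hs := Real.sqrt_nonneg (V * L)
  rcases h with ⟨rfl, h⟩ | h
  · have h1 : V / 162 ≤ √(V * L) := Real.le_sqrt_of_sq_le (by nlinarith)
    have h2 : L / (1 / 162) = 162 * L := by ring
    rw [h2] at hR
    linarith
  · have h1 : √(V * L) = η * V := by
      rw [← h, show V * (η ^ 2 * V) = (η * V) ^ 2 by ring]
      exact Real.sqrt_sq (by positivity)
    have h2 : L / η = η * V := by
      rw [← h]
      field_simp
    rw [h2] at hR
    linarith

theorem exists_rate {L V : ℝ} (hL : 0 < L) :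
    ∃ η : ℝ, 0 < η ∧ η ≤ 1 / 162 ∧ (η = 1 / 162 ∧ V ≤ 162 ^ 2 * L ∨ η ^ 2 * V = L) := by
  rcases le_or_gt V (162 ^ 2 * L) with h | h
  · exact ⟨1 / 162, by norm_num, le_rfl, Or.inl ⟨rfl, h⟩⟩
  · have hV : 0 < V := lt_trans (by positivity) h
    refine ⟨√(L / V), Real.sqrt_pos.2 (by positivity), ?_, Or.inr ?_⟩
    · refine Real.sqrt_le_iff.2 ⟨by norm_num, ?_⟩
      rw [div_le_iff₀ hV]
      linarith
    · rw [Real.sq_sqrt (by positivity)]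
      field_simp

/-- The balancing learning rate when the path-length itself depends on the learning rate, by the
intermediate value theorem. -/
theorem exists_rate_of_continuousOn {L B : ℝ} (hL : 0 < L) {V : ℝ → ℝ} (hV : ∀ η, 0 < η → V η ≤ B)
    (hc : ContinuousOn V (Set.Ioi 0)) :
    ∃ η : ℝ, 0 < η ∧ η ≤ 1 / 162 ∧ (η = 1 / 162 ∧ V η ≤ 162 ^ 2 * L ∨ η ^ 2 * V η = L) := by
  rcases le_or_gt (V (1 / 162)) (162 ^ 2 * L) with h | h
  · exact ⟨1 / 162, by norm_num, le_rfl, Or.inl ⟨rfl, h⟩⟩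
  · have hB : 162 ^ 2 * L < B := h.trans_le (hV _ (by norm_num))
    have hB0 : 0 < B := lt_trans (by positivity) hB
    have hη₀ : 0 < √(L / B) := Real.sqrt_pos.2 (by positivity)
    have hη₁ : √(L / B) ≤ 1 / 162 := by
      refine Real.sqrt_le_iff.2 ⟨by norm_num, ?_⟩
      rw [div_le_iff₀ hB0]
      linarith
    have hlo : √(L / B) ^ 2 * V √(L / B) ≤ L := by
      rw [Real.sq_sqrt (by positivity)]
      calc L / B * V √(L / B) ≤ L / B * B := by
            gcongr
            exact hV _ hη₀
        _ = L := by field_simp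
    obtain ⟨η, hη, hηL⟩ := intermediate_value_Icc hη₁
      (f := fun η => η ^ 2 * V η) ((continuousOn_id.pow 2).mul
        (hc.mono fun η hη => lt_of_lt_of_le hη₀ hη.1)) ⟨hlo, by linarith⟩
    exact ⟨η, lt_of_lt_of_le hη₀ hη.1, hη.2, Or.inr hηL⟩

end Bandit

theorem theorem2 :
    ∃ C : ℝ, 0 < C ∧ ∀ K T : ℕ, 1 ≤ K → K ≤ T →
      -- the two regret bounds for a given learning rate
      (∀ η : ℝ, 0 < η → η ≤ 1 / 162 →
        ∀ (Ξ : Type u) [MeasurableSpace Ξ] (P : Measure Ξ) [IsProbabilityMeasure P]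
          (A : Bandit.Adversary K Ξ),
          A.regret P T η (8 * η)
              ≤ C * (K * Real.log T / η + η * A.pulledVariation P T η (8 * η)) ∧
          A.regret P T η (8 * η)
              ≤ C * (K * Real.log T / η + η * A.maxPathLength P T η (8 * η))) ∧
      -- tuning with a known value of (or upper bound on) the path-length
      (∀ V : ℝ, 0 ≤ V → ∃ η : ℝ, 0 < η ∧ η ≤ 1 / 162 ∧
        ∀ (Ξ : Type u) [MeasurableSpace Ξ] (P : Measure Ξ) [IsProbabilityMeasure P]
          (A : Bandit.Adversary K Ξ), A.maxPathLength P T η (8 * η) ≤ V →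
          A.regret P T η (8 * η) ≤ C * (√(K * V * Real.log T) + K * Real.log T)) ∧
      -- tuning for a given adversary, in terms of the path-length of the tuned run itself
      (∀ (Ξ : Type u) [MeasurableSpace Ξ] (P : Measure Ξ) [IsProbabilityMeasure P]
        (A : Bandit.Adversary K Ξ), ∃ η : ℝ, 0 < η ∧ η ≤ 1 / 162 ∧
          A.regret P T η (8 * η)
            ≤ C * (√(K * A.maxPathLength P T η (8 * η) * Real.log T) + K * Real.log T)) := by
  refine ⟨1296, by norm_num, fun K T hK hKT => ?_⟩
  have hlog : 0 ≤ K * Real.log T := mul_nonneg K.cast_nonneg (Real.log_natCast_nonneg T)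
  -- `K ln T = 0` only when `T = 1`, hence when there is a single arm
  have hone : 0 = K * Real.log T → K = 1 := by
    intro h0
    by_contra hne
    have hT : (1 : ℝ) < T := by exact_mod_cast (by omega : 1 < T)
    have hK0 : (0 : ℝ) < K := by exact_mod_cast hK
    exact (mul_pos hK0 (Real.log_pos hT)).ne h0
  have hbound : ∀ η : ℝ, 0 < η → η ≤ 1 / 162 →
      ∀ (Ξ : Type u) [MeasurableSpace Ξ] (P : Measure Ξ) [IsProbabilityMeasure P]
        (A : Bandit.Adversary K Ξ), A.regret P T η (8 * η)
          ≤ 8 * (K * Real.log T / η + η * A.maxPathLength P T η (8 * η)) := by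
    intro η hη hη' Ξ _ P _ A
    refine (A.regret_le hK hKT P hη hη').trans ?_
    gcongr
    exact A.pulledVariation_le_maxPathLength hK P T hη (by linarith)
  have hsqrt : ∀ V : ℝ, √(K * V * Real.log T) = √(V * (K * Real.log T)) := fun V => by
    congr 1
    ring
  refine ⟨fun η hη hη' Ξ _ P _ A => ⟨?_, ?_⟩, fun V hV => ?_, fun Ξ _ P _ A => ?_⟩
  · refine (A.regret_le hK hKT P hη hη').trans ?_
    have := A.pulledVariation_nonneg hK P T hη (α := 8 * η) (by linarith)
    gcongr
    norm_num
  · refine (hbound η hη hη' Ξ P A).trans ?_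
    have := A.maxPathLength_nonneg hK P T hη (α := 8 * η) (by linarith)
    gcongr
    norm_num
  · rcases hlog.eq_or_lt with h0 | hpos
    · obtain rfl := hone h0
      refine ⟨1 / 162, by norm_num, le_rfl, fun Ξ _ P _ A _ => ?_⟩
      rw [A.regret_one_arm]
      positivity
    · obtain ⟨η, hη, hη', h⟩ := Bandit.exists_rate (V := V) hpos
      refine ⟨η, hη, hη', fun Ξ _ P _ A hA => ?_⟩
      rw [hsqrt]
      refine Bandit.tuned_bound hlog hV hη ((hbound η hη hη' Ξ P A).trans ?_) h
      gcongr
  · rcases hlog.eq_or_lt with h0 | hpos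
    · obtain rfl := hone h0
      refine ⟨1 / 162, by norm_num, le_rfl, ?_⟩
      rw [A.regret_one_arm]
      positivity
    · obtain ⟨η, hη, hη', h⟩ := Bandit.exists_rate_of_continuousOn hpos
        (fun η hη => A.maxPathLength_le hK P T hη (α := 8 * η) (by linarith))
        (A.continuousOn_maxPathLength hK P T)
      refine ⟨η, hη, hη', ?_⟩
      rw [hsqrt]
      exact Bandit.tuned_bound hlog (A.maxPathLength_nonneg hK P T hη (by linarith)) hη
        (hbound η hη hη' Ξ P A) h
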